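/- Let $m$ be a natural number, $[m]=\{1,\dots,m\}$, let $(\Omega,\mathcal F,\Pr)$ be a probability space, and let $\{W(k)\}_{k\ge 1}$ be an independent sequence of random $m\times m$ matrices with Borel-measurable real entries $W_{ij}(k)$, such that each $W(k)$ is almost surely (row-)stochastic, i.e. has nonnegative entries and row sums $1$. Assume that the chain is - balanced: there is $\alpha>0$ such that for all $k\ge1$ and all $S\subset[m]$ with $S\ne\emptyset$, $S\neq[m]$, writing $\bar S=[m]\setminus S$, $$\mathbb E\Big[\sum_{i\in S,\,j\in\bar S}W_{ij}(k)\Big]\;\ge\;\alpha\,\mathbb E\Big[\sum_{i\in\bar S,\,j\in S}W_{ij}(k)\Big];$$ - strongly aperiodic: there is $\gamma\in(0,1]$ such that $\mathbb E[W_{ii}(k)W_{ij}(k)]\ge\gamma\,\mathbb E[W_{ij}(k)]$ for all $i\ne j$ in $[m]$ and all $k\ge1$. For $k>t_0\ge0$ let $W(k:t_0)=W(k)W(k-1)\cdots W(t_0+1)$. The infinite flow graph of the chain is the random graph $G^\infty(\omega)$ on $[m]$ in which distinct $i,j$ are joined by an edge if and only if $\sum_{k=1}^\infty\big(W_{ij}(k,\omega)+W_{ji}(k,\omega)\big)=\infty$.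 Then for every $t_0\ge0$ there is a random matrix $W(\infty:t_0)$ with measurable entries, almost surely stochastic, such that $W(k:t_0)\to W(\infty:t_0)$ almost surely as $k\to\infty$. Moreover, for almost every $\omega$, the $i$-th and the $j$-th rows of $W(\infty:t_0)(\omega)$ are equal for all $i,j$ that lie in the same connected component of $G^\infty(\omega)$. -/

import Mathlib

open MeasureTheory ProbabilityTheory Filter Topology
open scoped ENNReal

/-- A random (row-)stochastic `m × m` matrix: its entries are Borel measurable, and it is
row-stochastic almost surely. -/
structure IsRandomStochastic {Ω : Type*} [MeasurableSpace Ω] {m : ℕ} (μ : Measure Ω)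
    (M : Ω → Matrix (Fin m) (Fin m) ℝ) : Prop where
  measurable_entry : ∀ i j, Measurable fun ω => M ω i j
  stochastic : ∀ᵐ ω ∂μ, M ω ∈ Matrix.rowStochastic ℝ (Fin m)

/-- An independent random chain `{W(k)}`, `k ≥ 1`, of `m × m` stochastic matrices.
Chains are indexed by the natural numbers; the value `W 0` is never used.
Independence is with respect to the Borel (product) σ-algebra on real `m × m` arrays. -/
structure IsIndependentRandomChain {Ω : Type*} [MeasurableSpace Ω] {m : ℕ} (μ : Measure Ω)
    (W : ℕ → Ω → Matrix (Fin m) (Fin m) ℝ) : Prop where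
  randomStochastic : ∀ k, 1 ≤ k → IsRandomStochastic μ (W k)
  indep : iIndepFun
    (fun (k : ℕ) (ω : Ω) => (fun i j => W (k + 1) ω i j : Fin m → Fin m → ℝ)) μ

/-- Strong aperiodicity: `E[W_ii(k) W_ij(k)] ≥ γ E[W_ij(k)]` for some `γ ∈ (0, 1]`, all `i ≠ j`
and all `k ≥ 1`. -/
def IsStronglyAperiodic {Ω : Type*} [MeasurableSpace Ω] {m : ℕ} (μ : Measure Ω)
    (W : ℕ → Ω → Matrix (Fin m) (Fin m) ℝ) : Prop :=
  ∃ γ : ℝ, 0 < γ ∧ γ ≤ 1 ∧ ∀ k, 1 ≤ k → ∀ i j : Fin m, i ≠ j →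
    γ * ∫ ω, W k ω i j ∂μ ≤ ∫ ω, W k ω i i * W k ω i j ∂μ

/-- The total weight `A_{S S̄} = ∑_{i ∈ S, j ∉ S} A_ij`. -/
def cutWeight {m : ℕ} (A : Matrix (Fin m) (Fin m) ℝ) (S : Finset (Fin m)) : ℝ :=
  ∑ i ∈ S, ∑ j ∈ Sᶜ, A i j

/-- Balancedness: `E[W_{S S̄}(k)] ≥ α E[W_{S̄ S}(k)]` for some `α > 0`, all nontrivial `S`
and all `k ≥ 1`. -/
def IsBalanced {Ω : Type*} [MeasurableSpace Ω] {m : ℕ} (μ : Measure Ω)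
    (W : ℕ → Ω → Matrix (Fin m) (Fin m) ℝ) : Prop :=
  ∃ α : ℝ, 0 < α ∧ ∀ k, 1 ≤ k → ∀ S : Finset (Fin m), S ≠ ∅ → S ≠ Finset.univ →
    α * ∫ ω, cutWeight (W k ω) Sᶜ ∂μ ≤ ∫ ω, cutWeight (W k ω) S ∂μ

/-- The infinite flow graph of a sequence `{A(k)}`, `k ≥ 1`: distinct `i` and `j` are adjacent iff
`∑_{k ≥ 1} (A_ij(k) + A_ji(k)) = ∞`. (Loops play no role for connected components.) -/
def infiniteFlowGraph {m : ℕ} (A : ℕ → Matrix (Fin m) (Fin m) ℝ) : SimpleGraph (Fin m) where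
  Adj i j := i ≠ j ∧ ∑' k : ℕ, ENNReal.ofReal (A (k + 1) i j + A (k + 1) j i) = ∞
  symm := ⟨fun i j h => ⟨h.1.symm, by simpa only [add_comm] using h.2⟩⟩
  loopless := ⟨fun _ h => h.1 rfl⟩

/-- The product `A(k : t₀) = A(k) A(k-1) ⋯ A(t₀+1)` for `k > t₀`, and the identity for
`k ≤ t₀`. -/
def chainProd {m : ℕ} (A : ℕ → Matrix (Fin m) (Fin m) ℝ) (t₀ : ℕ) :
    ℕ → Matrix (Fin m) (Fin m) ℝ
  | 0 => 1
  | k + 1 => if t₀ ≤ k then A (k + 1) * chainProd A t₀ k else 1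

/-!
The proof is a martingale argument along an absolute probability sequence of the expected chain.

Strong aperiodicity bounds the diagonal of `E[W k]` from below. For balanced stochastic matrices
with such a diagonal, the transposed action preserves a compact set of positive vectors
(`vecMul_mem_spreadVectors`): a light set of indices next to much heavier ones gains at least as
much mass as it loses. Compactness then yields row vectors `π n = π (n + 1) E[B n]` with entries
bounded away from zero (`exists_absolute_sequence`), where `B n` denotes `W (t₀ + n + 1)`.

Let `x n` be a column of the product up to time `n`, with values in `[0, 1]`. By convexity all the
moments `∑ i, π n i * x n i ^ q` are bounded supermartingales and converge almost surely
(`ae_exists_tendsto_moment`). For `q = 2` the loss of a step dominates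
`∑ i l, E[B_il (x i - x l) ^ 2]`, again by strong aperiodicity, so the total cost
`∑ n, B_il(n) (x n i - x n l) ^ 2` is finite almost surely (`ae_summable_cost`). In particular the
increments of `x` tend to zero.

The rest is pathwise. Convergence of all moments against weights bounded below confines the limit
points of every `x n i` to a finite set, and a sequence with vanishing increments cannot keep
jumping between the points of a finite set, so `x n i` converges (`exists_tendsto_of_moments`).
If the limits at `i` and `l` differ, finiteness of the cost makes the flow between `i` and `l`
summable (`summable_of_summable_mul_sq`), so adjacent indices of the infinite flow graph have
equal limit rows. No zero-one law for the graph is needed.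
-/

/-! ### Absolute probability sequences of balanced chains -/

/-- The set of nonnegative vectors of total mass `m` that give every nonempty `S` a mass of at
least `β ^ (m - |S|)`. For small `β` the bounds for different `|S|` are far apart, so a set close
to its bound consists of points much lighter than all the others. -/
def spreadVectors (m : ℕ) (β : ℝ) : Set (Fin m → ℝ) :=
  {y | (∀ i, 0 ≤ y i) ∧ ∑ i, y i = m ∧
    ∀ S : Finset (Fin m), S.Nonempty → β ^ (m - S.card) ≤ ∑ i ∈ S, y i}

lemma one_mem_spreadVectors {m : ℕ} {β : ℝ} (h0 : 0 ≤ β) (h1 : β ≤ 1) :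
    (1 : Fin m → ℝ) ∈ spreadVectors m β := by
  refine ⟨fun i => zero_le_one, by simp, fun S hS => ?_⟩
  have h : (1 : ℝ) ≤ S.card := by exact_mod_cast hS.card_pos
  simpa using (pow_le_one₀ h0 h1).trans h

lemma le_of_mem_spreadVectors {m : ℕ} {β : ℝ} {y : Fin m → ℝ} (hy : y ∈ spreadVectors m β)
    (i : Fin m) : β ^ (m - 1) ≤ y i := by
  simpa using hy.2.2 {i} (Finset.singleton_nonempty i)

lemma isCompact_spreadVectors (m : ℕ) (β : ℝ) : IsCompact (spreadVectors m β) := by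
  have hcpt : IsCompact (Set.univ.pi fun _ : Fin m => Set.Icc (0 : ℝ) m) :=
    isCompact_univ_pi fun _ => isCompact_Icc
  refine hcpt.of_isClosed_subset ?_ fun y hy i _ => ⟨hy.1 i, ?_⟩
  · simp only [spreadVectors, Set.ofPred_and, Set.ofPred_forall]
    refine (isClosed_iInter fun i => ?_).inter ((?_ : IsClosed _).inter
      (isClosed_iInter fun S => isClosed_iInter fun _ => ?_))
    · exact isClosed_le continuous_const (continuous_apply i)
    · exact isClosed_eq (by fun_prop) continuous_const
    · exact isClosed_le continuous_const (by fun_prop)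
  · rw [← hy.2.1]
    exact Finset.single_le_sum (fun j _ => hy.1 j) (Finset.mem_univ i)

/-- Transposed action of a balanced stochastic matrix with diagonal at least `c`. If a set `S`
holds a mass of at least `β ^ (m - |S|) / c`, its diagonal alone retains enough. Otherwise every
point outside `S` is heavier than every point of `S` by a factor of at least `1 / α`, so that by
balancedness `S` gains at least as much as it loses. -/
lemma vecMul_mem_spreadVectors {m : ℕ} {A : Matrix (Fin m) (Fin m) ℝ} {α c β : ℝ}
    (hA : A ∈ Matrix.rowStochastic ℝ (Fin m)) (hα : 0 < α) (hc : 0 < c)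
    (hdiag : ∀ i, c ≤ A i i)
    (hbal : ∀ S : Finset (Fin m), S ≠ ∅ → S ≠ Finset.univ → α * cutWeight A S ≤ cutWeight A Sᶜ)
    (hβ : 0 < β) (hβc : β * (1 + α⁻¹) ≤ c)
    {y : Fin m → ℝ} (hy : y ∈ spreadVectors m β) :
    Matrix.vecMul y A ∈ spreadVectors m β := by
  obtain ⟨hA0, hA1⟩ := Matrix.mem_rowStochastic_iff_sum.1 hA
  obtain ⟨hy0, hym, hyS⟩ := hy
  have hval : ∀ j, Matrix.vecMul y A j = ∑ i, y i * A i j := fun j => rfl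
  have htot : ∑ j, Matrix.vecMul y A j = m := by
    simp only [hval]
    rw [Finset.sum_comm]
    simp only [← Finset.mul_sum, hA1, mul_one, hym]
  refine ⟨fun j => hval j ▸ Finset.sum_nonneg fun i _ => mul_nonneg (hy0 i) (hA0 i j), htot,
    fun S hS => ?_⟩
  by_cases hSu : S = Finset.univ
  · rw [hSu, htot, ← hym]
    exact hyS _ (hSu ▸ hS)
  have hsplit : ∑ j ∈ S, Matrix.vecMul y A j
      = ∑ i ∈ S, ∑ j ∈ S, y i * A i j + ∑ i ∈ Sᶜ, ∑ j ∈ S, y i * A i j := by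
    simp only [hval]
    rw [Finset.sum_comm, ← Finset.sum_add_sum_compl S]
  have hin0 : 0 ≤ ∑ i ∈ Sᶜ, ∑ j ∈ S, y i * A i j :=
    Finset.sum_nonneg fun i _ => Finset.sum_nonneg fun j _ => mul_nonneg (hy0 i) (hA0 i j)
  set δ : ℝ := β ^ (m - S.card) with hδ
  have hδ0 : 0 < δ := pow_pos hβ _
  by_cases hbig : δ / c ≤ ∑ i ∈ S, y i
  · -- the diagonal keeps a fraction `c` of the mass of `S`
    have h1 : c * ∑ i ∈ S, y i ≤ ∑ i ∈ S, ∑ j ∈ S, y i * A i j := by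
      rw [Finset.mul_sum]
      refine Finset.sum_le_sum fun i hi => ?_
      calc c * y i ≤ y i * A i i := by
            rw [mul_comm]; exact mul_le_mul_of_nonneg_left (hdiag i) (hy0 i)
        _ ≤ _ := Finset.single_le_sum (f := fun j => y i * A i j)
            (fun j _ => mul_nonneg (hy0 i) (hA0 i j)) hi
    have h2 : δ ≤ c * ∑ i ∈ S, y i := by
      rw [div_le_iff₀ hc] at hbig
      linarith
    rw [hsplit]
    linarith
  · push Not at hbig
    have hcard : S.card < m := by
      have := Finset.card_lt_univ_of_notMem (s := S)
        (Classical.not_forall.1 fun h => hSu (Finset.eq_univ_iff_forall.2 h)).choose_spec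
      simpa using this
    -- points of `S` are light, points outside are heavy
    have hlight : ∀ i ∈ S, y i ≤ δ / c := fun i hi =>
      (Finset.single_le_sum (fun j _ => hy0 j) hi).trans hbig.le
    have hheavy : ∀ i ∈ Sᶜ, δ / c * α⁻¹ ≤ y i := by
      intro i hi
      have hiS : i ∉ S := Finset.mem_compl.1 hi
      have h1 := hyS (insert i S) (Finset.insert_nonempty i S)
      rw [Finset.sum_insert hiS, Finset.card_insert_of_notMem hiS] at h1
      have h2 : δ = β ^ (m - (S.card + 1)) * β := by
        rw [hδ, ← pow_succ]
        congr 1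
        omega
      have h3 : δ / c * (1 + α⁻¹) ≤ β ^ (m - (S.card + 1)) := by
        rw [div_mul_eq_mul_div, div_le_iff₀ hc, h2, mul_assoc]
        exact mul_le_mul_of_nonneg_left hβc (pow_pos hβ _).le
      linarith
    have hstay : ∑ i ∈ S, ∑ j ∈ S, y i * A i j
        = ∑ i ∈ S, y i - ∑ i ∈ S, ∑ j ∈ Sᶜ, y i * A i j := by
      rw [← Finset.sum_sub_distrib]
      refine Finset.sum_congr rfl fun i _ => ?_
      rw [eq_sub_iff_add_eq, Finset.sum_add_sum_compl, ← Finset.mul_sum, hA1, mul_one]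
    have hout : ∑ i ∈ S, ∑ j ∈ Sᶜ, y i * A i j ≤ δ / c * cutWeight A S := by
      simp only [cutWeight, Finset.mul_sum]
      exact Finset.sum_le_sum fun i hi => Finset.sum_le_sum fun j _ =>
        mul_le_mul_of_nonneg_right (hlight i hi) (hA0 i j)
    have hin : δ / c * α⁻¹ * cutWeight A Sᶜ ≤ ∑ i ∈ Sᶜ, ∑ j ∈ S, y i * A i j := by
      simp only [cutWeight, Finset.mul_sum, compl_compl]
      exact Finset.sum_le_sum fun i hi => Finset.sum_le_sum fun j _ =>
        mul_le_mul_of_nonneg_right (hheavy i hi) (hA0 i j)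
    have hflow : δ / c * cutWeight A S ≤ δ / c * α⁻¹ * cutWeight A Sᶜ := by
      rw [mul_assoc]
      refine mul_le_mul_of_nonneg_left ?_ (div_pos hδ0 hc).le
      rw [inv_mul_eq_div, le_div_iff₀ hα, mul_comm]
      exact hbal S hS.ne_empty hSu
    have := hyS S hS
    rw [hsplit, hstay]
    linarith

/-- The row vector `(1, …, 1) A(n + d - 1) ⋯ A(n)`. -/
def backwardOnes {m : ℕ} (A : ℕ → Matrix (Fin m) (Fin m) ℝ) : ℕ → ℕ → Fin m → ℝ
  | 0, _ => 1
  | d + 1, n => Matrix.vecMul (backwardOnes A d (n + 1)) (A n)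

/-- An absolute probability sequence `π(n) = π(n + 1) A(n)` (normalized to total mass `m`) exists
inside every compact set that contains `(1, …, 1)` and is mapped into itself by each `A(n)`: it is
the limit along a free ultrafilter in `K` of `(1, …, 1) A(K - 1) ⋯ A(n)`. -/
lemma exists_absolute_sequence {m : ℕ} (A : ℕ → Matrix (Fin m) (Fin m) ℝ) {C : Set (Fin m → ℝ)}
    (hC : IsCompact C) (h1 : 1 ∈ C) (hAC : ∀ n, ∀ y ∈ C, Matrix.vecMul y (A n) ∈ C) :
    ∃ π : ℕ → Fin m → ℝ, (∀ n, π n ∈ C) ∧ ∀ n, π n = Matrix.vecMul (π (n + 1)) (A n) := by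
  have hmem : ∀ d n, backwardOnes A d n ∈ C := by
    intro d
    induction d with
    | zero => exact fun _ => h1
    | succ d ih => exact fun n => hAC n _ (ih (n + 1))
  set U : Ultrafilter ℕ := hyperfilter ℕ
  have hlim : ∀ n, ∃ p ∈ C, Tendsto (fun K => backwardOnes A (K - n) n) U (𝓝 p) := fun n =>
    hC.ultrafilter_le_nhds' (U.map fun K => backwardOnes A (K - n) n)
      (Filter.mem_map.2 (Filter.univ_mem' fun K => hmem _ _))
  choose π hπC hπ using hlim
  refine ⟨π, hπC, fun n => ?_⟩
  have hcont : Continuous fun y : Fin m → ℝ => Matrix.vecMul y (A n) := by fun_prop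
  refine tendsto_nhds_unique (hπ n) (((hcont.tendsto _).comp (hπ (n + 1))).congr' ?_)
  have hU : (U : Filter ℕ) ≤ atTop := by
    rw [← Nat.cofinite_eq_atTop]
    exact hyperfilter_le_cofinite
  filter_upwards [hU (eventually_gt_atTop n)] with K hK
  obtain ⟨d, rfl⟩ := Nat.exists_eq_add_of_lt hK
  rw [show n + d + 1 - n = d + 1 by omega]
  simp only [Function.comp_apply, backwardOnes]
  rw [show n + d + 1 - (n + 1) = d by omega]

/-! ### Convergence of deterministic trajectories -/

/-- A bounded real sequence with vanishing increments whose values approach the (finite) zero set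
of a nonzero polynomial converges: infinitely many crossings of a level `c` would make `c` a
cluster point, so only zeros of the polynomial are crossed infinitely often. -/
lemma exists_tendsto_of_tendsto_eval_zero {u : ℕ → ℝ} {a b : ℝ} (hu : ∀ n, u n ∈ Set.Icc a b)
    (hstep : Tendsto (fun n => u (n + 1) - u n) atTop (𝓝 0)) {Q : Polynomial ℝ} (hQ : Q ≠ 0)
    (hQu : Tendsto (fun n => Q.eval (u n)) atTop (𝓝 0)) :
    ∃ l, Tendsto u atTop (𝓝 l) := by
  refine tendsto_of_no_upcrossings dense_univ ?_ (isBoundedUnder_of ⟨b, fun n => (hu n).2⟩)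
    (isBoundedUnder_of ⟨a, fun n => (hu n).1⟩)
  rintro r - s - hrs ⟨hr, hs⟩
  obtain ⟨c, ⟨hrc, hcs⟩, hc⟩ : ∃ c ∈ Set.Ioo r s, ¬ Q.IsRoot c := by
    by_contra! h
    exact (Set.Ioo_infinite hrs) ((Q.finite_setOfPred_isRoot hQ).subset h)
  have hcross : ∃ᶠ n in atTop, u n ≤ c ∧ c < u (n + 1) := by
    rw [frequently_atTop] at hr hs ⊢
    intro N
    obtain ⟨n, hn, hun⟩ := hr N
    have hex : ∃ k, n ≤ k ∧ c < u k := by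
      obtain ⟨k, hk, huk⟩ := hs n
      exact ⟨k, hk, hcs.trans huk⟩
    classical
    obtain ⟨hk1, hk2⟩ := Nat.find_spec hex
    have hmin := fun j => Nat.find_min hex (m := j)
    generalize Nat.find hex = k at hk1 hk2 hmin
    have hnk : n ≠ k := by
      rintro rfl
      linarith
    obtain ⟨j, rfl⟩ : ∃ j, k = j + 1 := ⟨k - 1, by omega⟩
    refine ⟨j, by omega, ?_, hk2⟩
    by_contra! hj
    exact hmin j (by omega) ⟨by omega, hj⟩
  have hnear : ∀ ε > 0, ∃ᶠ n in atTop, |u n - c| < ε := by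
    intro ε hε
    refine (hcross.and_eventually ((Metric.tendsto_nhds.1 hstep) ε hε)).mono ?_
    rintro n ⟨⟨h1, h2⟩, h3⟩
    rw [Real.dist_eq, sub_zero] at h3
    have := le_abs_self (u (n + 1) - u n)
    rw [abs_lt]
    constructor <;> linarith
  have hQc : 0 < |Q.eval c| / 2 := by
    have := abs_pos.2 hc
    positivity
  obtain ⟨ε, hε, hεQ⟩ := Metric.continuous_iff.1 Q.continuous c _ hQc
  obtain ⟨n, hn1, hn2⟩ := ((hnear ε hε).and_eventually ((Metric.tendsto_nhds.1 hQu) _ hQc)).exists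
  have h1 := hεQ (u n) hn1
  rw [Real.dist_eq] at h1 hn2
  rw [sub_zero] at hn2
  have h2 := abs_sub_abs_le_abs_sub (Q.eval c) (Q.eval (u n))
  rw [abs_sub_comm] at h1
  linarith

/-- If all moments of the measures `∑ i, π n i • δ_{x n i}` converge, with weights bounded and
bounded away from zero, and the trajectories have vanishing increments, then each trajectory
converges. For a cluster point `x'` of `x` the polynomial `∏ i, (X - x' i) ^ 2` has integrals
tending to zero, so that all `x n i` approach its roots. -/
lemma exists_tendsto_of_moments {m : ℕ} {x π : ℕ → Fin m → ℝ} {p : ℝ} {C : Set (Fin m → ℝ)}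
    (hp : 0 < p) (hC : IsCompact C) (hπC : ∀ n, π n ∈ C) (hπ : ∀ n i, p ≤ π n i)
    (hx : ∀ n i, x n i ∈ Set.Icc (0 : ℝ) 1)
    (hstep : ∀ i, Tendsto (fun n => x (n + 1) i - x n i) atTop (𝓝 0))
    (hmom : ∀ q : ℕ, ∃ l, Tendsto (fun n => ∑ i, π n i * x n i ^ q) atTop (𝓝 l)) (i : Fin m) :
    ∃ l, Tendsto (fun n => x n i) atTop (𝓝 l) := by
  choose L hL using hmom
  have hpoly : ∀ Q : Polynomial ℝ, Tendsto (fun n => ∑ i, π n i * Q.eval (x n i)) atTop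
      (𝓝 (∑ q ∈ Finset.range (Q.natDegree + 1), Q.coeff q * L q)) := by
    intro Q
    refine (tendsto_finsetSum _ fun q _ => (hL q).const_mul (Q.coeff q)).congr fun n => ?_
    simp only [Polynomial.eval_eq_sum_range, Finset.mul_sum]
    rw [Finset.sum_comm]
    exact Finset.sum_congr rfl fun _ _ => Finset.sum_congr rfl fun _ _ => by ring
  have hcpt : IsCompact (C ×ˢ Set.univ.pi fun _ : Fin m => Set.Icc (0 : ℝ) 1) :=
    hC.prod (isCompact_univ_pi fun _ => isCompact_Icc)
  obtain ⟨⟨π', x'⟩, -, φ, hφ, hlim⟩ := hcpt.tendsto_subseq (x := fun n => (π n, x n))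
    fun n => ⟨hπC n, fun i _ => hx n i⟩
  set Q : Polynomial ℝ := ∏ i, (Polynomial.X - Polynomial.C (x' i)) ^ 2 with hQdef
  have hQ : Q ≠ 0 :=
    Finset.prod_ne_zero_iff.2 fun i _ => pow_ne_zero _ (Polynomial.X_sub_C_ne_zero _)
  have hQnonneg : ∀ t, 0 ≤ Q.eval t := by
    intro t
    rw [hQdef, Polynomial.eval_prod]
    exact Finset.prod_nonneg fun i _ => by
      rw [Polynomial.eval_pow]
      exact sq_nonneg _
  have hQroot : ∀ i, Q.eval (x' i) = 0 := by
    intro i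
    rw [hQdef, Polynomial.eval_prod]
    exact Finset.prod_eq_zero (Finset.mem_univ i) (by simp)
  have hQlim : Tendsto (fun n => ∑ i, π n i * Q.eval (x n i)) atTop (𝓝 0) := by
    have hcont : Continuous fun z : (Fin m → ℝ) × (Fin m → ℝ) =>
        ∑ i, z.1 i * Q.eval (z.2 i) :=
      continuous_finsetSum _ fun i _ =>
        ((continuous_apply i).comp continuous_fst).mul
          (Q.continuous.comp ((continuous_apply i).comp continuous_snd))
    have h1 := (hcont.tendsto (π', x')).comp hlim
    simp only [hQroot, mul_zero, Finset.sum_const_zero] at h1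
    have h2 := (hpoly Q).comp hφ.tendsto_atTop
    rw [← tendsto_nhds_unique h2 h1]
    exact hpoly Q
  refine exists_tendsto_of_tendsto_eval_zero (fun n => hx n i) (hstep i) hQ ?_
  have hdiv := hQlim.const_mul p⁻¹
  rw [mul_zero] at hdiv
  refine squeeze_zero (fun n => hQnonneg _) (fun n => ?_) hdiv
  rw [inv_mul_eq_div, le_div_iff₀ hp, mul_comm]
  calc p * Q.eval (x n i) ≤ π n i * Q.eval (x n i) :=
        mul_le_mul_of_nonneg_right (hπ n i) (hQnonneg _)
    _ ≤ _ := Finset.single_le_sum (f := fun i => π n i * Q.eval (x n i))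
        (fun j _ => mul_nonneg (hp.le.trans (hπ n j)) (hQnonneg _)) (Finset.mem_univ i)

/-- The variance of the averaging step of a stochastic vector `b` dominates the terms that
involve one distinguished index. -/
lemma sq_sum_le_sub {m : ℕ} {b x : Fin m → ℝ} (hb : ∀ j, 0 ≤ b j) (hb1 : ∑ j, b j = 1)
    (i : Fin m) :
    (∑ j, b j * x j) ^ 2 ≤ ∑ j, b j * x j ^ 2 - ∑ j, b i * b j * (x i - x j) ^ 2 := by
  set f : Fin m → Fin m → ℝ := fun j l => b j * b l * (x j - x l) ^ 2 with hf
  have hf0 : ∀ j l, 0 ≤ f j l := fun j l => mul_nonneg (mul_nonneg (hb j) (hb l)) (sq_nonneg _)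
  have hvar : ∑ j, ∑ l, f j l = 2 * (∑ j, b j * x j ^ 2 - (∑ j, b j * x j) ^ 2) := by
    have h : ∀ j l, f j l = b j * x j ^ 2 * b l + b j * (b l * x l ^ 2)
        - 2 * ((b j * x j) * (b l * x l)) := fun j l => by rw [hf]; ring
    simp only [h, Finset.sum_sub_distrib, Finset.sum_add_distrib, ← Finset.mul_sum,
      ← Finset.sum_mul, hb1]
    ring
  have hrow : ∑ j, f i j + ∑ j, f i j ≤ ∑ j, ∑ l, f j l := by
    rw [← Finset.add_sum_erase Finset.univ (fun j => ∑ l, f j l) (Finset.mem_univ i)]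
    refine add_le_add (le_refl (∑ j, f i j)) ?_
    rw [← Finset.add_sum_erase _ (f i) (Finset.mem_univ i),
      show f i i = 0 by simp [hf], zero_add]
    refine Finset.sum_le_sum fun j _ => ?_
    have : f i j = f j i := by simp only [hf]; ring
    rw [this]
    exact Finset.single_le_sum (fun l _ => hf0 j l) (Finset.mem_univ i)
  have : ∑ j, f i j = ∑ j, b i * b j * (x i - x j) ^ 2 := rfl
  linarith

/-- In a stochastic averaging step, the squared displacement is at most the average squared
distance (Jensen). -/
lemma sq_sum_sub_le {m : ℕ} {b x : Fin m → ℝ} (hb : ∀ j, 0 ≤ b j) (hb1 : ∑ j, b j = 1)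
    (t : ℝ) : (∑ j, b j * x j - t) ^ 2 ≤ ∑ j, b j * (t - x j) ^ 2 := by
  have h := Real.pow_arith_mean_le_arith_mean_pow_of_even Finset.univ b (fun j => t - x j)
    (fun j _ => hb j) hb1 even_two
  have h2 : ∑ j, b j * (t - x j) = t - ∑ j, b j * x j := by
    simp only [mul_sub, Finset.sum_sub_distrib, ← Finset.sum_mul, hb1, one_mul]
  rw [h2] at h
  linarith [sub_sq_comm (∑ j, b j * x j) t]

/-- A finite quadratic cost between trajectories with distinct limits forces the weights to be
summable. -/
lemma summable_of_summable_mul_sq {a u v : ℕ → ℝ} {r s : ℝ} (ha : ∀ n, 0 ≤ a n)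
    (hu : Tendsto u atTop (𝓝 r)) (hv : Tendsto v atTop (𝓝 s)) (hrs : r ≠ s)
    (hsum : Summable fun n => a n * (u n - v n) ^ 2) : Summable a := by
  have hd : 0 < (r - s) ^ 2 := by
    have := sub_ne_zero.2 hrs
    positivity
  have hev : ∀ᶠ n in atTop, (r - s) ^ 2 / 2 < (u n - v n) ^ 2 :=
    ((hu.sub hv).pow 2).eventually (lt_mem_nhds (by linarith))
  refine Summable.of_norm_bounded_eventually_nat (hsum.mul_left ((r - s) ^ 2 / 2)⁻¹) ?_
  filter_upwards [hev] with n hn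
  rw [Real.norm_of_nonneg (ha n), inv_mul_eq_div, le_div_iff₀ (by positivity)]
  exact mul_le_mul_of_nonneg_left hn.le (ha n)

/-! ### Independent stochastic chains and their products -/

/-- The left product `A(n - 1) ⋯ A(0)`. -/
def leftProd {m : ℕ} (A : ℕ → Matrix (Fin m) (Fin m) ℝ) : ℕ → Matrix (Fin m) (Fin m) ℝ
  | 0 => 1
  | n + 1 => A n * leftProd A n

lemma leftProd_mem {m : ℕ} {A : ℕ → Matrix (Fin m) (Fin m) ℝ}
    (hA : ∀ n, A n ∈ Matrix.rowStochastic ℝ (Fin m)) (n : ℕ) :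
    leftProd A n ∈ Matrix.rowStochastic ℝ (Fin m) := by
  induction n with
  | zero => exact Submonoid.one_mem _
  | succ n ih => exact Submonoid.mul_mem _ (hA n) ih

lemma leftProd_mem_Icc {m : ℕ} {A : ℕ → Matrix (Fin m) (Fin m) ℝ}
    (hA : ∀ n, A n ∈ Matrix.rowStochastic ℝ (Fin m)) (n : ℕ) (i j : Fin m) :
    leftProd A n i j ∈ Set.Icc (0 : ℝ) 1 :=
  ⟨Matrix.nonneg_of_mem_rowStochastic (leftProd_mem hA n),
    Matrix.le_one_of_mem_rowStochastic (leftProd_mem hA n)⟩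

lemma leftProd_succ_apply {m : ℕ} (A : ℕ → Matrix (Fin m) (Fin m) ℝ) (n : ℕ) (i j : Fin m) :
    leftProd A (n + 1) i j = ∑ l, A n i l * leftProd A n l j := rfl

/-- An independent sequence of random matrices that are stochastic at every sample point. -/
structure IsStochasticChain {Ω : Type*} [MeasurableSpace Ω] {m : ℕ} (μ : Measure Ω)
    (B : ℕ → Ω → Matrix (Fin m) (Fin m) ℝ) : Prop where
  measurable_entry : ∀ n i j, Measurable fun ω => B n ω i j
  stochastic : ∀ n ω, B n ω ∈ Matrix.rowStochastic ℝ (Fin m)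
  indep : iIndepFun (fun (n : ℕ) (ω : Ω) => (fun i j => B n ω i j : Fin m → Fin m → ℝ)) μ

/-- A measurable function with values in the unit interval is integrable. -/
lemma integrable_of_mem_unitInterval {Ω : Type*} [MeasurableSpace Ω] {μ : Measure Ω}
    [IsFiniteMeasure μ] {f : Ω → ℝ} (hf : Measurable f) (h : ∀ ω, f ω ∈ Set.Icc (0 : ℝ) 1) :
    Integrable f μ :=
  Integrable.of_bound hf.aestronglyMeasurable 1 <| ae_of_all _ fun ω => by
    rw [Real.norm_of_nonneg (h ω).1]
    exact (h ω).2

/-- A series of nonnegative functions with summable integrals converges almost everywhere. -/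
lemma ae_summable_of_summable_integral {Ω : Type*} [MeasurableSpace Ω] {μ : Measure Ω}
    {f : ℕ → Ω → ℝ} (hint : ∀ n, Integrable (f n) μ) (h0 : ∀ n ω, 0 ≤ f n ω)
    (hsum : Summable fun n => ∫ ω, f n ω ∂μ) : ∀ᵐ ω ∂μ, Summable fun n => f n ω := by
  have hmeas : ∀ n, AEMeasurable (fun ω => ENNReal.ofReal (f n ω)) μ :=
    fun n => (hint n).aemeasurable.ennreal_ofReal
  have h1 : ∫⁻ ω, ∑' n, ENNReal.ofReal (f n ω) ∂μ ≠ ∞ := by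
    rw [lintegral_tsum hmeas]
    simp only [← ofReal_integral_eq_lintegral_ofReal (hint _) (ae_of_all _ (h0 _))]
    exact hsum.tsum_ofReal_ne_top
  filter_upwards [ae_lt_top' (AEMeasurable.tsum hmeas) h1] with ω hω
  have h2 := ENNReal.summable_toReal hω.ne
  simpa only [ENNReal.toReal_ofReal (h0 _ ω)] using h2

section Chain

variable {Ω : Type*} [MeasurableSpace Ω] {m : ℕ} {μ : Measure Ω}
  {B : ℕ → Ω → Matrix (Fin m) (Fin m) ℝ}

namespace IsStochasticChain

lemma measurable_array (hB : IsStochasticChain μ B) (n : ℕ) :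
    Measurable fun ω => (fun i j => B n ω i j : Fin m → Fin m → ℝ) :=
  measurable_pi_lambda _ fun i => measurable_pi_lambda _ fun j => hB.measurable_entry n i j

lemma entry_mem_Icc (hB : IsStochasticChain μ B) (n : ℕ) (ω : Ω) (i j : Fin m) :
    B n ω i j ∈ Set.Icc (0 : ℝ) 1 :=
  ⟨Matrix.nonneg_of_mem_rowStochastic (hB.stochastic n ω),
    Matrix.le_one_of_mem_rowStochastic (hB.stochastic n ω)⟩

/-- The filtration whose `n`-th σ-algebra is generated by `B 0, …, B (n - 1)`. -/
def past (hB : IsStochasticChain μ B) : Filtration ℕ (inferInstance : MeasurableSpace Ω) where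
  seq n := ⨆ k ∈ Set.Iio n, MeasurableSpace.comap
    (fun ω => (fun i j => B k ω i j : Fin m → Fin m → ℝ)) inferInstance
  mono' _ _ h := biSup_mono fun _ hk => lt_of_lt_of_le hk h
  le' _ := iSup₂_le fun k _ => (hB.measurable_array k).comap_le

lemma measurable_past_entry (hB : IsStochasticChain μ B) {k n : ℕ} (hkn : k < n) (i j : Fin m) :
    Measurable[hB.past n] fun ω => B k ω i j := by
  have h : MeasurableSpace.comap (fun ω => (fun i j => B k ω i j : Fin m → Fin m → ℝ))
      inferInstance ≤ hB.past n :=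
    le_iSup₂ (f := fun k (_ : k ∈ Set.Iio n) => MeasurableSpace.comap
      (fun ω => (fun i j => B k ω i j : Fin m → Fin m → ℝ)) inferInstance) k hkn
  have hij : Measurable fun M : Fin m → Fin m → ℝ => M i j := by fun_prop
  exact (hij.comp (comap_measurable _)).mono h le_rfl

lemma measurable_past_leftProd (hB : IsStochasticChain μ B) (n : ℕ) (i j : Fin m) :
    Measurable[hB.past n] fun ω => leftProd (fun l => B l ω) n i j := by
  suffices h : ∀ k, ∀ n ≥ k, ∀ i j, Measurable[hB.past n] fun ω => leftProd (fun l => B l ω) k i j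
    from h n n le_rfl i j
  intro k
  induction k with
  | zero => exact fun _ _ _ _ => measurable_const
  | succ k ih =>
    intro n hn i j
    simp only [leftProd_succ_apply]
    exact Finset.measurable_fun_sum _ fun l _ =>
      (hB.measurable_past_entry hn i l).mul (ih n (by omega) l j)

lemma measurable_leftProd (hB : IsStochasticChain μ B) (n : ℕ) (i j : Fin m) :
    Measurable fun ω => leftProd (fun l => B l ω) n i j :=
  (hB.measurable_past_leftProd n i j).mono (hB.past.le n) le_rfl

lemma sq_sub_mem_Icc (hB : IsStochasticChain μ B) (n : ℕ) (i l j : Fin m) (ω : Ω) :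
    (leftProd (fun k => B k ω) n i j - leftProd (fun k => B k ω) n l j) ^ 2
      ∈ Set.Icc (0 : ℝ) 1 := by
  have h1 := leftProd_mem_Icc (fun k => hB.stochastic k ω) n i j
  have h2 := leftProd_mem_Icc (fun k => hB.stochastic k ω) n l j
  refine ⟨sq_nonneg _, (sq_le_one_iff_abs_le_one _).2 (abs_le.2 ⟨?_, ?_⟩)⟩ <;>
    linarith [h1.1, h1.2, h2.1, h2.2]

lemma measurable_past_sq_sub (hB : IsStochasticChain μ B) (n : ℕ) (i l j : Fin m) :
    Measurable[hB.past n] fun ω =>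
      (leftProd (fun k => B k ω) n i j - leftProd (fun k => B k ω) n l j) ^ 2 :=
  ((hB.measurable_past_leftProd n i j).sub (hB.measurable_past_leftProd n l j)).pow_const 2

/-- The expected matrix `E[B n]`. The hypothesis on the chain serves only for dot notation. -/
noncomputable def mean (_hB : IsStochasticChain μ B) (n : ℕ) : Matrix (Fin m) (Fin m) ℝ :=
  fun i j => ∫ ω, B n ω i j ∂μ

/-- The `q`-th moment of the `j`-th column of the product `B (n - 1) ⋯ B 0` with respect to the
weights `π n`. The hypothesis on the chain serves only for dot notation. -/
def moment (_hB : IsStochasticChain μ B) (π : ℕ → Fin m → ℝ) (j : Fin m) (q n : ℕ) (ω : Ω) : ℝ :=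
  ∑ i, π n i * leftProd (fun l => B l ω) n i j ^ q

lemma measurable_past_moment (hB : IsStochasticChain μ B) (π : ℕ → Fin m → ℝ) (j : Fin m)
    (q n : ℕ) : Measurable[hB.past n] (hB.moment π j q n) :=
  Finset.measurable_fun_sum _ fun i _ =>
    ((hB.measurable_past_leftProd n i j).pow_const q).const_mul (π n i)

lemma leftProd_pow_mem_Icc (hB : IsStochasticChain μ B) (n : ℕ) (i j : Fin m) (q : ℕ) (ω : Ω) :
    leftProd (fun l => B l ω) n i j ^ q ∈ Set.Icc (0 : ℝ) 1 := by
  have h := leftProd_mem_Icc (fun k => hB.stochastic k ω) n i j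
  exact ⟨pow_nonneg h.1 q, pow_le_one₀ h.1 h.2⟩

lemma indep_past (hB : IsStochasticChain μ B) (n : ℕ) :
    Indep (MeasurableSpace.comap (fun ω => (fun i j => B n ω i j : Fin m → Fin m → ℝ))
      inferInstance) (hB.past n) μ := by
  have h := indep_iSup_of_disjoint (fun k => (hB.measurable_array k).comap_le) hB.indep.iIndep
    (S := {n}) (T := Set.Iio n) (by simp)
  simp only [Set.mem_singleton_iff, iSup_iSup_eq_left] at h
  exact h

variable [IsProbabilityMeasure μ]

/-- A function of `B n` is averaged out when it is conditioned on the past. -/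
lemma condExp_mul (hB : IsStochasticChain μ B) (n : ℕ) {g : (Fin m → Fin m → ℝ) → ℝ}
    (hg : Measurable g) (hgi : Integrable (fun ω => g (B n ω)) μ) {h : Ω → ℝ}
    (hh : Measurable[hB.past n] h) (hh1 : ∀ ω, h ω ∈ Set.Icc (0 : ℝ) 1) :
    Integrable (fun ω => g (B n ω) * h ω) μ ∧
    μ[fun ω => g (B n ω) * h ω | hB.past n] =ᵐ[μ] fun ω => (∫ ω', g (B n ω') ∂μ) * h ω := by
  have hint : Integrable (fun ω => g (B n ω) * h ω) μ :=
    hgi.mul_bdd (c := 1) (hh.mono (hB.past.le n) le_rfl).aestronglyMeasurable <|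
      ae_of_all _ fun ω => by
        rw [Real.norm_of_nonneg (hh1 ω).1]
        exact (hh1 ω).2
  refine ⟨hint, ?_⟩
  have h1 := condExp_mul_of_stronglyMeasurable_right (hh.stronglyMeasurable) hint hgi
  have h2 := condExp_indep_eq (hB.measurable_array n).comap_le (hB.past.le n)
    (f := fun ω => g (B n ω)) (hg.comp (comap_measurable _)).stronglyMeasurable (hB.indep_past n)
  filter_upwards [h1, h2] with ω h1 h2
  refine h1.trans ?_
  rw [Pi.mul_apply, h2]

lemma integral_mul (hB : IsStochasticChain μ B) (n : ℕ) {g : (Fin m → Fin m → ℝ) → ℝ}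
    (hg : Measurable g) (hgi : Integrable (fun ω => g (B n ω)) μ) {h : Ω → ℝ}
    (hh : Measurable[hB.past n] h) (hh1 : ∀ ω, h ω ∈ Set.Icc (0 : ℝ) 1) :
    ∫ ω, g (B n ω) * h ω ∂μ = (∫ ω, g (B n ω) ∂μ) * ∫ ω, h ω ∂μ := by
  rw [← integral_condExp (hB.past.le n), integral_congr_ae (hB.condExp_mul n hg hgi hh hh1).2,
    integral_const_mul]

lemma integrable_entry (hB : IsStochasticChain μ B) (n : ℕ) (i j : Fin m) :
    Integrable (fun ω => B n ω i j) μ :=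
  integrable_of_mem_unitInterval (hB.measurable_entry n i j) fun ω => hB.entry_mem_Icc n ω i j

lemma mean_mem (hB : IsStochasticChain μ B) (n : ℕ) :
    hB.mean n ∈ Matrix.rowStochastic ℝ (Fin m) := by
  refine Matrix.mem_rowStochastic_iff_sum.2
    ⟨fun i j => integral_nonneg fun ω => (hB.entry_mem_Icc n ω i j).1, fun i => ?_⟩
  simp only [mean]
  rw [← integral_finsetSum _ fun j _ => hB.integrable_entry n i j]
  simp [Matrix.sum_row_of_mem_rowStochastic (hB.stochastic n _)]

/-- Strong aperiodicity bounds the diagonal of the expected matrix from below: summing over `j`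
gives `E[B_ii] ≥ γ (1 - E[B_ii])`. -/
lemma le_mean_diag (hB : IsStochasticChain μ B) {γ : ℝ} (hγ : 0 < γ) {n : ℕ}
    (hap : ∀ i j : Fin m, i ≠ j →
      γ * ∫ ω, B n ω i j ∂μ ≤ ∫ ω, B n ω i i * B n ω i j ∂μ) (i : Fin m) :
    γ / (1 + γ) ≤ hB.mean n i i := by
  have hprod : ∀ j, Integrable (fun ω => B n ω i i * B n ω i j) μ := fun j =>
    integrable_of_mem_unitInterval
      ((hB.measurable_entry n i i).mul (hB.measurable_entry n i j)) fun ω =>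
      unitInterval.mul_mem (hB.entry_mem_Icc n ω i i) (hB.entry_mem_Icc n ω i j)
  have h1 : ∑ j, ∫ ω, B n ω i i * B n ω i j ∂μ = hB.mean n i i := by
    rw [← integral_finsetSum _ fun j _ => hprod j]
    simp only [← Finset.mul_sum, Matrix.sum_row_of_mem_rowStochastic (hB.stochastic n _), mul_one,
      mean]
  have h2 : ∑ j, hB.mean n i j = 1 := Matrix.sum_row_of_mem_rowStochastic (hB.mean_mem n) i
  have h3 : 0 ≤ ∫ ω, B n ω i i * B n ω i i ∂μ := integral_nonneg fun ω => mul_self_nonneg _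
  rw [← Finset.add_sum_erase _ _ (Finset.mem_univ i)] at h1 h2
  have h4 : γ * ∑ j ∈ Finset.univ.erase i, hB.mean n i j
      ≤ ∑ j ∈ Finset.univ.erase i, ∫ ω, B n ω i i * B n ω i j ∂μ := by
    rw [Finset.mul_sum]
    exact Finset.sum_le_sum fun j hj => hap i j (Finset.ne_of_mem_erase hj).symm
  rw [div_le_iff₀ (by linarith)]
  have h5 : ∑ j ∈ Finset.univ.erase i, hB.mean n i j = 1 - hB.mean n i i := by linarith
  rw [h5] at h4
  linarith

/-- The expected chain of a balanced, strongly aperiodic chain has an absolute probability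
sequence (of total mass `m`) that stays in a compact set and is bounded away from zero. -/
lemma exists_absolute_sequence_mean (hB : IsStochasticChain μ B) {α γ : ℝ} (hα : 0 < α)
    (hγ : 0 < γ)
    (hbal : ∀ n, ∀ S : Finset (Fin m), S ≠ ∅ → S ≠ Finset.univ →
      α * ∫ ω, cutWeight (B n ω) Sᶜ ∂μ ≤ ∫ ω, cutWeight (B n ω) S ∂μ)
    (hap : ∀ n, ∀ i j : Fin m, i ≠ j →
      γ * ∫ ω, B n ω i j ∂μ ≤ ∫ ω, B n ω i i * B n ω i j ∂μ) :
    ∃ (π : ℕ → Fin m → ℝ) (C : Set (Fin m → ℝ)) (p : ℝ), IsCompact C ∧ 0 < p ∧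
      (∀ n, π n ∈ C) ∧ (∀ n i, p ≤ π n i) ∧ ∀ n, π n = Matrix.vecMul (π (n + 1)) (hB.mean n) := by
  have hcut : ∀ n S, ∫ ω, cutWeight (B n ω) S ∂μ = cutWeight (hB.mean n) S := by
    intro n S
    simp only [cutWeight, mean]
    rw [integral_finsetSum _ fun i _ => integrable_finsetSum _ fun j _ => hB.integrable_entry n i j]
    exact Finset.sum_congr rfl fun i _ => integral_finsetSum _ fun j _ => hB.integrable_entry n i j
  have hc : 0 < γ / (1 + γ) := by positivity
  have hα1 : 0 < 1 + α⁻¹ := by positivity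
  -- the largest ratio allowed by `vecMul_mem_spreadVectors` for the diagonal bound `γ / (1 + γ)`
  set β : ℝ := γ / (1 + γ) / (1 + α⁻¹)
  have hβ : 0 < β := div_pos hc hα1
  have hβ1 : β ≤ 1 := by
    refine div_le_one_of_le₀ ?_ hα1.le
    have h1 : γ / (1 + γ) ≤ 1 := div_le_one_of_le₀ (by linarith) (by linarith)
    have h2 : 0 < α⁻¹ := inv_pos.2 hα
    linarith
  obtain ⟨π, hπC, hπ⟩ := exists_absolute_sequence hB.mean (isCompact_spreadVectors m β)
    (one_mem_spreadVectors hβ.le hβ1) fun n y hy =>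
      vecMul_mem_spreadVectors (hB.mean_mem n) hα hc (hB.le_mean_diag hγ (hap n))
        (fun S hS hSu => by
          have h := hbal n Sᶜ (fun h => hSu (by simpa using h)) (fun h => hS (by simpa using h))
          rwa [hcut, hcut, compl_compl] at h)
        hβ (div_mul_cancel₀ _ hα1.ne').le hy
  exact ⟨π, _, β ^ (m - 1), isCompact_spreadVectors m β, pow_pos hβ _, hπC,
    fun n i => le_of_mem_spreadVectors (hπC n) i, hπ⟩

/-! ### Moments along an absolute probability sequence -/

lemma integrable_leftProd_pow (hB : IsStochasticChain μ B) (n : ℕ) (i j : Fin m) (q : ℕ) :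
    Integrable (fun ω => leftProd (fun l => B l ω) n i j ^ q) μ :=
  integrable_of_mem_unitInterval ((hB.measurable_leftProd n i j).pow_const q)
    fun ω => hB.leftProd_pow_mem_Icc n i j q ω

lemma integrable_moment (hB : IsStochasticChain μ B) (π : ℕ → Fin m → ℝ) (j : Fin m) (q n : ℕ) :
    Integrable (hB.moment π j q n) μ :=
  integrable_finsetSum _ fun i _ => (hB.integrable_leftProd_pow n i j q).const_mul (π n i)

lemma integrable_weighted_column (hB : IsStochasticChain μ B) (p : Fin m → ℝ) (n : ℕ)
    (l : Fin m) : Integrable (fun ω => ∑ i, p i * B n ω i l) μ :=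
  integrable_finsetSum _ fun i _ => (hB.integrable_entry n i l).const_mul (p i)

lemma integral_weighted_column (hB : IsStochasticChain μ B) (p : Fin m → ℝ) (n : ℕ)
    (l : Fin m) : ∫ ω, ∑ i, p i * B n ω i l ∂μ = Matrix.vecMul p (hB.mean n) l := by
  rw [integral_finsetSum _ fun i _ => (hB.integrable_entry n i l).const_mul (p i)]
  simp only [integral_const_mul]
  rfl

/-- By Jensen's inequality every moment is a bounded supermartingale along an absolute probability
sequence, hence converges almost surely. -/
lemma ae_exists_tendsto_moment (hB : IsStochasticChain μ B) {π : ℕ → Fin m → ℝ}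
    (hπ0 : ∀ n i, 0 ≤ π n i) {c : ℝ} (hπm : ∀ n, ∑ i, π n i ≤ c)
    (hπ : ∀ n, π n = Matrix.vecMul (π (n + 1)) (hB.mean n)) (j : Fin m) (q : ℕ) :
    ∀ᵐ ω ∂μ, ∃ l, Tendsto (fun n => hB.moment π j q n ω) atTop (𝓝 l) := by
  have hsuper : Supermartingale (hB.moment π j q) hB.past μ := by
    refine supermartingale_nat (fun n => (hB.measurable_past_moment π j q n).stronglyMeasurable)
      (hB.integrable_moment π j q) fun n => ?_
    have hterm := fun l : Fin m => hB.condExp_mul n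
      (g := fun M => ∑ i, π (n + 1) i * M i l) (by fun_prop)
      (hB.integrable_weighted_column (π (n + 1)) n l)
      ((hB.measurable_past_leftProd n l j).pow_const q) (hB.leftProd_pow_mem_Icc n l j q)
    have hle : hB.moment π j q (n + 1) ≤ ∑ l, fun ω =>
        (∑ i, π (n + 1) i * B n ω i l) * leftProd (fun l => B l ω) n l j ^ q := by
      intro ω
      rw [Finset.sum_apply]
      simp only [Finset.sum_mul]
      rw [Finset.sum_comm]
      refine Finset.sum_le_sum fun i _ => ?_
      simp only [mul_assoc, ← Finset.mul_sum]
      refine mul_le_mul_of_nonneg_left ?_ (hπ0 _ i)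
      rw [leftProd_succ_apply]
      exact Real.pow_arith_mean_le_arith_mean_pow _ _ _
        (fun l _ => (hB.entry_mem_Icc n ω i l).1)
        (Matrix.sum_row_of_mem_rowStochastic (hB.stochastic n ω) i)
        (fun l _ => (leftProd_mem_Icc (fun k => hB.stochastic k ω) n l j).1) q
    have h1 := condExp_mono (m := hB.past n) (hB.integrable_moment π j q (n + 1))
      (integrable_finsetSum' _ fun l _ => (hterm l).1) (ae_of_all μ hle)
    have h2 := condExp_finsetSum (s := Finset.univ) (fun l _ => (hterm l).1) (hB.past n)
    filter_upwards [h1, h2, ae_all_iff.2 fun l => (hterm l).2] with ω h1 h2 h3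
    refine h1.trans (h2.trans ?_).le
    rw [Finset.sum_apply]
    refine Finset.sum_congr rfl fun l _ => ?_
    rw [h3 l, hB.integral_weighted_column, ← hπ]
  have hbound : ∀ n ω, |hB.moment π j q n ω| ≤ c := by
    intro n ω
    have h0 : 0 ≤ hB.moment π j q n ω := Finset.sum_nonneg fun i _ =>
      mul_nonneg (hπ0 n i) (hB.leftProd_pow_mem_Icc n i j q ω).1
    rw [abs_of_nonneg h0]
    exact (Finset.sum_le_sum fun i _ =>
      mul_le_of_le_one_right (hπ0 n i) (hB.leftProd_pow_mem_Icc n i j q ω).2).trans (hπm n)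
  have hnorm : ∀ n, eLpNorm ((-hB.moment π j q) n) 1 μ ≤ c.toNNReal := by
    intro n
    refine (eLpNorm_le_of_ae_bound (C := c) (ae_of_all _ fun ω => ?_)).trans ?_
    · simpa using hbound n ω
    · simp [ENNReal.ofReal]
  filter_upwards [hsuper.neg.exists_ae_tendsto_of_bdd hnorm] with ω ⟨l, hl⟩
  exact ⟨-l, by simpa using hl.neg⟩

/-! ### Finite quadratic cost -/

/-- The second moment decreases in expectation by at least the expected cost of the step. -/
lemma integral_moment_two_succ_add_le (hB : IsStochasticChain μ B) {π : ℕ → Fin m → ℝ} {p γ : ℝ}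
    (hp : 0 < p) (hπp : ∀ n i, p ≤ π n i)
    (hπ : ∀ n, π n = Matrix.vecMul (π (n + 1)) (hB.mean n))
    (hap : ∀ n, ∀ i j : Fin m, i ≠ j →
      γ * ∫ ω, B n ω i j ∂μ ≤ ∫ ω, B n ω i i * B n ω i j ∂μ) (j : Fin m) (n : ℕ) :
    ∫ ω, hB.moment π j 2 (n + 1) ω ∂μ + p * γ * ∑ i, ∑ l, ∫ ω, B n ω i l *
        (leftProd (fun k => B k ω) n i j - leftProd (fun k => B k ω) n l j) ^ 2 ∂μ
      ≤ ∫ ω, hB.moment π j 2 n ω ∂μ := by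
  set x : Fin m → Ω → ℝ := fun i ω => leftProd (fun k => B k ω) n i j with hx
  have hpair : ∀ i l, Integrable (fun ω => B n ω i i * B n ω i l) μ := fun i l =>
    integrable_of_mem_unitInterval
      ((hB.measurable_entry n i i).mul (hB.measurable_entry n i l)) fun ω =>
      unitInterval.mul_mem (hB.entry_mem_Icc n ω i i) (hB.entry_mem_Icc n ω i l)
  -- the three kinds of terms, with the randomness of `B n` factored out
  have hA := fun l : Fin m => hB.condExp_mul n (g := fun M => ∑ i, π (n + 1) i * M i l)
    (by fun_prop) (hB.integrable_weighted_column (π (n + 1)) n l)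
    ((hB.measurable_past_leftProd n l j).pow_const 2) (hB.leftProd_pow_mem_Icc n l j 2)
  have hA' := fun l : Fin m => hB.integral_mul n (g := fun M => ∑ i, π (n + 1) i * M i l)
    (by fun_prop) (hB.integrable_weighted_column (π (n + 1)) n l)
    ((hB.measurable_past_leftProd n l j).pow_const 2) (hB.leftProd_pow_mem_Icc n l j 2)
  have hD := fun i l : Fin m => hB.condExp_mul n (g := fun M => M i i * M i l)
    (by fun_prop) (hpair i l) (hB.measurable_past_sq_sub n i l j) (hB.sq_sub_mem_Icc n i l j)
  have hD' := fun i l : Fin m => hB.integral_mul n (g := fun M => M i i * M i l)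
    (by fun_prop) (hpair i l) (hB.measurable_past_sq_sub n i l j) (hB.sq_sub_mem_Icc n i l j)
  have hE := fun i l : Fin m => hB.integral_mul n (g := fun M => M i l)
    (by fun_prop) (hB.integrable_entry n i l) (hB.measurable_past_sq_sub n i l j)
    (hB.sq_sub_mem_Icc n i l j)
  have hpoint : ∀ ω, hB.moment π j 2 (n + 1) ω ≤
      ∑ l, (∑ i, π (n + 1) i * B n ω i l) * x l ω ^ 2 -
      ∑ i, ∑ l, π (n + 1) i * (B n ω i i * B n ω i l * (x i ω - x l ω) ^ 2) := by
    intro ω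
    simp only [Finset.sum_mul]
    rw [Finset.sum_comm, ← Finset.sum_sub_distrib]
    refine Finset.sum_le_sum fun i _ => ?_
    simp only [mul_assoc (π (n + 1) i), ← Finset.mul_sum]
    rw [← mul_sub]
    refine mul_le_mul_of_nonneg_left ?_ (hp.le.trans (hπp _ i))
    rw [leftProd_succ_apply]
    exact sq_sum_le_sub (x := fun l => x l ω) (fun l => (hB.entry_mem_Icc n ω i l).1)
      (Matrix.sum_row_of_mem_rowStochastic (hB.stochastic n ω) i) i
  have hI1 : Integrable (fun ω => ∑ l, (∑ i, π (n + 1) i * B n ω i l) * x l ω ^ 2) μ :=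
    integrable_finsetSum _ fun l _ => (hA l).1
  have hI2 : ∀ i, Integrable (fun ω =>
      ∑ l, π (n + 1) i * (B n ω i i * B n ω i l * (x i ω - x l ω) ^ 2)) μ := fun i =>
    integrable_finsetSum _ fun l _ => (hD i l).1.const_mul _
  have hmean : ∫ ω, ∑ l, (∑ i, π (n + 1) i * B n ω i l) * x l ω ^ 2 ∂μ
      = ∫ ω, hB.moment π j 2 n ω ∂μ := by
    simp only [moment]
    rw [integral_finsetSum _ fun l _ => (hA l).1,
      integral_finsetSum _ fun i _ => (hB.integrable_leftProd_pow n i j 2).const_mul (π n i)]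
    refine Finset.sum_congr rfl fun l _ => ?_
    rw [hA' l, hB.integral_weighted_column, ← hπ, integral_const_mul]
  have hdrop : p * γ * ∑ i, ∑ l, ∫ ω, B n ω i l * (x i ω - x l ω) ^ 2 ∂μ ≤
      ∫ ω, ∑ i, ∑ l, π (n + 1) i * (B n ω i i * B n ω i l * (x i ω - x l ω) ^ 2) ∂μ := by
    rw [integral_finsetSum _ fun i _ => hI2 i, Finset.mul_sum]
    refine Finset.sum_le_sum fun i _ => ?_
    rw [integral_finsetSum _ fun l _ => (hD i l).1.const_mul _, Finset.mul_sum]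
    refine Finset.sum_le_sum fun l _ => ?_
    rw [integral_const_mul, hD' i l, hE i l]
    have h0 : 0 ≤ ∫ ω, (x i ω - x l ω) ^ 2 ∂μ := integral_nonneg fun ω => sq_nonneg _
    have h1 : 0 ≤ ∫ ω, B n ω i i * B n ω i l ∂μ := integral_nonneg fun ω =>
      mul_nonneg (hB.entry_mem_Icc n ω i i).1 (hB.entry_mem_Icc n ω i l).1
    rcases eq_or_ne i l with rfl | hil
    · simp
    · calc p * γ * ((∫ ω, B n ω i l ∂μ) * ∫ ω, (x i ω - x l ω) ^ 2 ∂μ)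
          = p * ((γ * ∫ ω, B n ω i l ∂μ) * ∫ ω, (x i ω - x l ω) ^ 2 ∂μ) := by ring
        _ ≤ p * ((∫ ω, B n ω i i * B n ω i l ∂μ) * ∫ ω, (x i ω - x l ω) ^ 2 ∂μ) :=
            mul_le_mul_of_nonneg_left (mul_le_mul_of_nonneg_right (hap n i l hil) h0) hp.le
        _ ≤ _ := mul_le_mul_of_nonneg_right (hπp _ i) (mul_nonneg h1 h0)
  have hmono := integral_mono (hB.integrable_moment π j 2 (n + 1))
    (hI1.sub (integrable_finsetSum _ fun i _ => hI2 i)) hpoint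
  have hsub := integral_sub hI1 (integrable_finsetSum Finset.univ fun i _ => hI2 i)
  simp only [Pi.sub_apply] at hmono
  rw [hsub, hmean] at hmono
  linarith

/-- Telescoping the decrease of the second moment: the total quadratic cost is almost surely
finite. -/
lemma ae_summable_cost (hB : IsStochasticChain μ B) {π : ℕ → Fin m → ℝ} {p γ : ℝ}
    (hp : 0 < p) (hπp : ∀ n i, p ≤ π n i)
    (hπ : ∀ n, π n = Matrix.vecMul (π (n + 1)) (hB.mean n)) (hγ : 0 < γ)
    (hap : ∀ n, ∀ i j : Fin m, i ≠ j →
      γ * ∫ ω, B n ω i j ∂μ ≤ ∫ ω, B n ω i i * B n ω i j ∂μ) (i l j : Fin m) :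
    ∀ᵐ ω ∂μ, Summable fun n => B n ω i l *
      (leftProd (fun k => B k ω) n i j - leftProd (fun k => B k ω) n l j) ^ 2 := by
  set D : ℕ → Fin m → Fin m → ℝ := fun n i l => ∫ ω, B n ω i l *
    (leftProd (fun k => B k ω) n i j - leftProd (fun k => B k ω) n l j) ^ 2 ∂μ with hD
  have hterm0 : ∀ n i l ω, 0 ≤ B n ω i l *
      (leftProd (fun k => B k ω) n i j - leftProd (fun k => B k ω) n l j) ^ 2 := fun n i l ω =>
    mul_nonneg (hB.entry_mem_Icc n ω i l).1 (sq_nonneg _)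
  have hD0 : ∀ n i l, 0 ≤ D n i l := fun n i l => integral_nonneg (hterm0 n i l)
  have htel : ∀ N, ∫ ω, hB.moment π j 2 N ω ∂μ
      + ∑ n ∈ Finset.range N, p * γ * ∑ i, ∑ l, D n i l ≤ ∫ ω, hB.moment π j 2 0 ω ∂μ := by
    intro N
    induction N with
    | zero => simp
    | succ N ih =>
      rw [Finset.sum_range_succ]
      have := hB.integral_moment_two_succ_add_le hp hπp hπ hap j N
      linarith
  have hsum : Summable fun n => p * γ * ∑ i, ∑ l, D n i l := by
    refine summable_of_sum_range_le (c := ∫ ω, hB.moment π j 2 0 ω ∂μ) (fun n => ?_) fun N => ?_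
    · exact mul_nonneg (mul_pos hp hγ).le
        (Finset.sum_nonneg fun i _ => Finset.sum_nonneg fun l _ => hD0 n i l)
    · have h0 : 0 ≤ ∫ ω, hB.moment π j 2 N ω ∂μ := integral_nonneg fun ω =>
        Finset.sum_nonneg fun i _ => mul_nonneg (hp.le.trans (hπp N i)) (sq_nonneg _)
      linarith [htel N]
  have hsum' : Summable fun n => ∑ i, ∑ l, D n i l :=
    (summable_mul_left_iff (mul_pos hp hγ).ne').1 hsum
  refine ae_summable_of_summable_integral
    (fun n => integrable_of_mem_unitInterval ?_ fun ω => ?_) (fun n => hterm0 n i l) ?_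
  · exact (hB.measurable_entry n i l).mul
      ((hB.measurable_past_sq_sub n i l j).mono (hB.past.le n) le_rfl)
  · exact unitInterval.mul_mem (hB.entry_mem_Icc n ω i l) (hB.sq_sub_mem_Icc n i l j ω)
  · refine hsum'.of_nonneg_of_le (fun n => hD0 n i l) fun n => ?_
    exact (Finset.single_le_sum (f := fun l => D n i l) (fun l _ => hD0 n i l)
      (Finset.mem_univ l)).trans (Finset.single_le_sum (f := fun i => ∑ l, D n i l)
      (fun i _ => Finset.sum_nonneg fun l _ => hD0 n i l) (Finset.mem_univ i))

/-- The entries of the products of a balanced, strongly aperiodic chain converge almost surely,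
and two rows have the same limit unless the flow between their indices is summable. -/
lemma ae_tendsto_leftProd (hB : IsStochasticChain μ B) {α γ : ℝ} (hα : 0 < α) (hγ : 0 < γ)
    (hbal : ∀ n, ∀ S : Finset (Fin m), S ≠ ∅ → S ≠ Finset.univ →
      α * ∫ ω, cutWeight (B n ω) Sᶜ ∂μ ≤ ∫ ω, cutWeight (B n ω) S ∂μ)
    (hap : ∀ n, ∀ i j : Fin m, i ≠ j →
      γ * ∫ ω, B n ω i j ∂μ ≤ ∫ ω, B n ω i i * B n ω i j ∂μ) :
    ∀ᵐ ω ∂μ, ∃ L : Matrix (Fin m) (Fin m) ℝ,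
      (∀ i j, Tendsto (fun n => leftProd (fun k => B k ω) n i j) atTop (𝓝 (L i j))) ∧
      ∀ i l, L i ≠ L l → Summable fun n => B n ω i l := by
  obtain ⟨π, C, p, hC, hp, hπC, hπp, hπ⟩ := hB.exists_absolute_sequence_mean hα hγ hbal hap
  obtain ⟨c, hc⟩ := (hC.image (f := fun y : Fin m → ℝ => ∑ i, y i) (by fun_prop)).bddAbove
  have hmom : ∀ᵐ ω ∂μ, ∀ j q, ∃ l, Tendsto (fun n => hB.moment π j q n ω) atTop (𝓝 l) :=
    ae_all_iff.2 fun j => ae_all_iff.2 fun q => hB.ae_exists_tendsto_moment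
      (fun n i => hp.le.trans (hπp n i)) (fun n => hc ⟨π n, hπC n, rfl⟩) hπ j q
  have hcost : ∀ᵐ ω ∂μ, ∀ i l j, Summable fun n => B n ω i l *
      (leftProd (fun k => B k ω) n i j - leftProd (fun k => B k ω) n l j) ^ 2 :=
    ae_all_iff.2 fun i => ae_all_iff.2 fun l => ae_all_iff.2 fun j =>
      hB.ae_summable_cost hp hπp hπ hγ hap i l j
  filter_upwards [hmom, hcost] with ω hmom hcost
  have hstep : ∀ i j, Tendsto (fun n => leftProd (fun k => B k ω) (n + 1) i j
      - leftProd (fun k => B k ω) n i j) atTop (𝓝 0) := by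
    intro i j
    have h1 := (summable_sum fun l (_ : l ∈ Finset.univ) => hcost i l j).tendsto_atTop_zero
    have h2 : Tendsto (fun n => (leftProd (fun k => B k ω) (n + 1) i j
        - leftProd (fun k => B k ω) n i j) ^ 2) atTop (𝓝 0) := by
      refine squeeze_zero (fun n => sq_nonneg _) (fun n => ?_) h1
      rw [leftProd_succ_apply]
      exact sq_sum_sub_le (fun l => (hB.entry_mem_Icc n ω i l).1)
        (Matrix.sum_row_of_mem_rowStochastic (hB.stochastic n ω) i) _
    have h3 := h2.sqrt
    simp only [Real.sqrt_sq_eq_abs, Real.sqrt_zero] at h3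
    exact (tendsto_zero_iff_abs_tendsto_zero _).2 h3
  have hconv : ∀ i j, ∃ l, Tendsto (fun n => leftProd (fun k => B k ω) n i j) atTop (𝓝 l) :=
    fun i j => exists_tendsto_of_moments (x := fun n i => leftProd (fun k => B k ω) n i j) hp hC
      hπC hπp (fun n i => leftProd_mem_Icc (fun k => hB.stochastic k ω) n i j)
      (fun i => hstep i j) (hmom j) i
  choose L hL using hconv
  refine ⟨L, hL, fun i l hil => ?_⟩
  obtain ⟨j, hj⟩ := Function.ne_iff.1 hil
  exact summable_of_summable_mul_sq (fun n => (hB.entry_mem_Icc n ω i l).1) (hL i j) (hL l j) hj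
    (hcost i l j)

end IsStochasticChain

end Chain

/-! ### Reduction to chains that are stochastic at every sample point -/

open Classical in
/-- The array itself if it is row-stochastic, and the identity matrix otherwise. -/
noncomputable def stochasticPart {m : ℕ} (M : Fin m → Fin m → ℝ) : Fin m → Fin m → ℝ :=
  if (∀ i j, 0 ≤ M i j) ∧ ∀ i, ∑ j, M i j = 1 then M else (1 : Matrix (Fin m) (Fin m) ℝ)

lemma measurable_stochasticPart (m : ℕ) : Measurable (stochasticPart (m := m)) := by
  refine Measurable.ite (IsClosed.measurableSet ?_) measurable_id measurable_const
  simp only [Set.ofPred_and, Set.ofPred_forall]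
  exact (isClosed_iInter fun i => isClosed_iInter fun j =>
    isClosed_le continuous_const (by fun_prop)).inter
    (isClosed_iInter fun i => isClosed_eq (by fun_prop) continuous_const)

lemma stochasticPart_mem {m : ℕ} (M : Fin m → Fin m → ℝ) :
    stochasticPart M ∈ Matrix.rowStochastic ℝ (Fin m) := by
  refine Matrix.mem_rowStochastic_iff_sum.2 ?_
  by_cases h : (∀ i j, 0 ≤ M i j) ∧ ∀ i, ∑ j, M i j = 1
  · rw [show stochasticPart M = M from if_pos h]
    exact h
  · rw [show stochasticPart M = (1 : Matrix (Fin m) (Fin m) ℝ) from if_neg h]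
    exact Matrix.mem_rowStochastic_iff_sum.1 (Submonoid.one_mem _)

lemma stochasticPart_of_mem {m : ℕ} {M : Matrix (Fin m) (Fin m) ℝ}
    (hM : M ∈ Matrix.rowStochastic ℝ (Fin m)) : stochasticPart M = M :=
  if_pos (Matrix.mem_rowStochastic_iff_sum.1 hM)

lemma chainProd_add {m : ℕ} (A : ℕ → Matrix (Fin m) (Fin m) ℝ) (t₀ n : ℕ) :
    chainProd A t₀ (n + t₀) = leftProd (fun k => A (t₀ + k + 1)) n := by
  induction n with
  | zero =>
    cases t₀ with
    | zero => rfl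
    | succ t => simp [chainProd, leftProd]
  | succ n ih =>
    rw [Nat.add_right_comm, chainProd, if_pos (Nat.le_add_left _ _), ih, leftProd,
      Nat.add_comm n t₀]

theorem mainTheorem1 {Ω : Type*} [MeasurableSpace Ω] (μ : Measure Ω) [IsProbabilityMeasure μ]
    (m : ℕ) (W : ℕ → Ω → Matrix (Fin m) (Fin m) ℝ)
    (hW : IsIndependentRandomChain μ W) (hbal : IsBalanced μ W)
    (haper : IsStronglyAperiodic μ W) (t₀ : ℕ) :
    ∃ Winf : Ω → Matrix (Fin m) (Fin m) ℝ,
      IsRandomStochastic μ Winf ∧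
      (∀ᵐ ω ∂μ, Tendsto (fun k => chainProd (fun l => W l ω) t₀ k) atTop (𝓝 (Winf ω))) ∧
      ∀ᵐ ω ∂μ, ∀ i j : Fin m,
        (infiniteFlowGraph fun l => W l ω).Reachable i j → Winf ω i = Winf ω j := by
  obtain ⟨α, hα, hbal⟩ := hbal
  obtain ⟨γ, hγ, -, hap⟩ := haper
  -- the tail of the chain after time `t₀`, made stochastic at every sample point
  set B : ℕ → Ω → Matrix (Fin m) (Fin m) ℝ := fun n ω => stochasticPart (W (t₀ + n + 1) ω)
  have hWmeas : ∀ n, Measurable fun ω => (fun i j => W (n + 1) ω i j : Fin m → Fin m → ℝ) :=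
    fun n => measurable_pi_lambda _ fun i => measurable_pi_lambda _ fun j =>
      (hW.randomStochastic (n + 1) (by omega)).measurable_entry i j
  have hB : IsStochasticChain μ B :=
    { measurable_entry := fun n i j => (measurable_pi_apply j).comp <| (measurable_pi_apply i).comp
        ((measurable_stochasticPart m).comp (hWmeas (t₀ + n)))
      stochastic := fun n ω => stochasticPart_mem _
      indep := (hW.indep.precomp (add_right_injective t₀)).comp (fun _ => stochasticPart)
        fun _ => measurable_stochasticPart m }
  have hBW : ∀ n, ∀ᵐ ω ∂μ, B n ω = W (t₀ + n + 1) ω := by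
    intro n
    filter_upwards [(hW.randomStochastic (t₀ + n + 1) (by omega)).stochastic] with ω hω
    exact stochasticPart_of_mem hω
  have hint : ∀ n (f : Matrix (Fin m) (Fin m) ℝ → ℝ),
      ∫ ω, f (B n ω) ∂μ = ∫ ω, f (W (t₀ + n + 1) ω) ∂μ := fun n f =>
    integral_congr_ae ((hBW n).mono fun ω hω => congrArg f hω)
  have hlim := hB.ae_tendsto_leftProd hα hγ
    (fun n S hS hSu => by
      rw [hint n fun M => cutWeight M Sᶜ, hint n fun M => cutWeight M S]
      exact hbal _ (by omega) S hS hSu)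
    (fun n i j hij => by
      rw [hint n fun M => M i j, hint n fun M => M i i * M i j]
      exact hap _ (by omega) i j hij)
  have hmlim : ∀ i j, ∃ f : Ω → ℝ, Measurable f ∧
      ∀ᵐ ω ∂μ, Tendsto (fun n => leftProd (fun k => B k ω) n i j) atTop (𝓝 (f ω)) := fun i j =>
    measurable_limit_of_tendsto_metrizable_ae
      (fun n => (hB.measurable_leftProd n i j).aemeasurable)
      (hlim.mono fun ω ⟨L, hL, _⟩ => ⟨L i j, hL i j⟩)
  choose Winf hWinf_meas hWinf using hmlim
  have hWinf' : ∀ᵐ ω ∂μ, ∀ i j,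
      Tendsto (fun n => leftProd (fun k => B k ω) n i j) atTop (𝓝 (Winf i j ω)) :=
    ae_all_iff.2 fun i => ae_all_iff.2 fun j => hWinf i j
  refine ⟨fun ω i j => Winf i j ω, ⟨hWinf_meas, ?_⟩, ?_, ?_⟩
  · filter_upwards [hWinf'] with ω hω
    refine Matrix.mem_rowStochastic_iff_sum.2 ⟨fun i j => ?_, fun i => ?_⟩
    · exact ge_of_tendsto' (hω i j) fun n =>
        (leftProd_mem_Icc (fun k => hB.stochastic k ω) n i j).1
    · refine tendsto_nhds_unique (tendsto_finsetSum _ fun j _ => hω i j) ?_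
      simp only [Matrix.sum_row_of_mem_rowStochastic (leftProd_mem (fun k => hB.stochastic k ω) _)]
      exact tendsto_const_nhds
  · -- the factors after time `t₀` agree almost surely with the modified ones
    filter_upwards [hWinf', ae_all_iff.2 hBW] with ω hω hBω
    rw [← tendsto_add_atTop_iff_nat t₀]
    simp only [chainProd_add, ← hBω]
    exact tendsto_pi_nhds.2 fun i => tendsto_pi_nhds.2 fun j => hω i j
  · filter_upwards [hWinf', ae_all_iff.2 hBW, hlim] with ω hω hBω ⟨L, hL, hsum⟩
    have hLW : ∀ i, L i = fun j => Winf i j ω := fun i =>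
      funext fun j => tendsto_nhds_unique (hL i j) (hω i j)
    have hadj : ∀ i j, (infiniteFlowGraph fun l => W l ω).Adj i j → L i = L j := by
      rintro i j ⟨-, htop⟩
      by_contra hij
      have h1 := (hsum i j hij).add (hsum j i (Ne.symm hij))
      simp only [hBω] at h1
      have h2 : Summable fun k => W (k + 1) ω i j + W (k + 1) ω j i := by
        rw [← summable_nat_add_iff t₀]
        simpa only [Nat.add_comm _ t₀] using h1
      exact h2.tsum_ofReal_ne_top htop
    rintro i j ⟨w⟩
    have hij : L i = L j := by
      induction w with
      | nil => rfl
      | cons h _ ih => exact (hadj _ _ h).trans ih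
    rw [hLW, hLW] at hij
    exact hij
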